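/- All Hilbert spaces are finite-dimensional. Let $\varrho_a,\varrho_b,\varrho_c$ be quantum states (positive semidefinite complex matrices of trace one) of bipartite systems $B_2C_1$, $C_2A_1$ and $A_2B_1$, respectively (the dimensions of the six subsystems are arbitrary), and let $\varrho_{\mathrm{BTN}}$ be the state $\varrho_b\otimes\varrho_c\otimes\varrho_a$ of $C_2A_1|A_2B_1|B_2C_1$ with its subsystems rearranged in the order $A_1A_2|B_1B_2|C_1C_2$. Let $\mathcal E_A,\mathcal E_B,\mathcal E_C$ be quantum channels (completely positive trace-preserving linear maps) from operators on $A_1A_2$, $B_1B_2$, $C_1C_2$ to operators on finite-dimensional systems $A,B,C$ (of arbitrary dimensions), respectively, and put $\varrho_{\mathrm{CTN}}=(\mathcal E_A\otimes\mathcal E_B\otimes\mathcal E_C)(\varrho_{\mathrm{BTN}})$. Let $(A_i)_i$, $(B_j)_j$, $(C_k)_k$ be finite families of observables (Hermitian operators) on $A$, $B$, $C$. Let $\Gamma$ be the covariance matrix of the family $\{M_m\}=\{A_i\otimes 1\otimes 1\}_i\cup\{1\otimes B_j\otimes 1\}_j\cup\{1\otimes 1\otimes C_k\}_k$ in the state $\varrho_{\mathrm{CTN}}$,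 that is, the complex matrix with entries $\Gamma_{mn}=\langle M_mM_n\rangle-\langle M_m\rangle\langle M_n\rangle$, where $\langle X\rangle=\operatorname{tr}(X\varrho_{\mathrm{CTN}})$. Write it in blocks according to the three families; denote by $\gamma_E$, $\gamma_F$, $\gamma_G$ its $(A,B)$, $(A,C)$ and $(B,C)$ off-diagonal blocks. Then there exist complex square matrices $\Upsilon^A_1,\Upsilon^A_2,\Upsilon^B_1,\Upsilon^B_2,\Upsilon^C_1,\Upsilon^C_2$ such that $$\Gamma=\begin{pmatrix}\Upsilon^A_2&\gamma_E&0\\ \gamma_E^T&\Upsilon^B_1&0\\ 0&0&0\end{pmatrix}+\begin{pmatrix}\Upsilon^A_1&0&\gamma_F\\ 0&0&0\\ \gamma_F^T&0&\Upsilon^C_2\end{pmatrix}+\begin{pmatrix}0&0&0\\ 0&\Upsilon^B_2&\gamma_G\\ 0&\gamma_G^T&\Upsilon^C_1\end{pmatrix}$$ and each of the three matrices on the right-hand side is positive semidefinite. -/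

import Mathlib

open scoped Kronecker Matrix ComplexOrder

noncomputable section

/-- A quantum state (density matrix): a positive semidefinite matrix of trace one. -/
structure IsState {n : Type*} [Fintype n] (ρ : Matrix n n ℂ) : Prop where
  posSemidef : ρ.PosSemidef
  trace_eq_one : ρ.trace = 1

/-- The tensor product `E ⊗ F` of two linear maps between matrix algebras, written out on matrix
units; it is the linear map with `(E ⊗ F) (X ⊗ Y) = E X ⊗ F Y`, see `tensorMap_kronecker`. -/
def tensorMap {m m' n n' : Type*} [Fintype m] [DecidableEq m] [Fintype n] [DecidableEq n]
    (E : Matrix m m ℂ →ₗ[ℂ] Matrix m' m' ℂ) (F : Matrix n n ℂ →ₗ[ℂ] Matrix n' n' ℂ) :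
    Matrix (m × n) (m × n) ℂ →ₗ[ℂ] Matrix (m' × n') (m' × n') ℂ where
  toFun X := ∑ i, ∑ j, ∑ k, ∑ l,
    X (i, k) (j, l) • (E (Matrix.single i j 1) ⊗ₖ F (Matrix.single k l 1))
  map_add' X Y := by
    simp only [Matrix.add_apply, add_smul, Finset.sum_add_distrib]
  map_smul' c X := by
    simp only [Matrix.smul_apply, smul_assoc, Finset.smul_sum, RingHom.id_apply]

theorem tensorMap_kronecker {m m' n n' : Type*} [Fintype m] [DecidableEq m]
    [Fintype n] [DecidableEq n]
    (E : Matrix m m ℂ →ₗ[ℂ] Matrix m' m' ℂ) (F : Matrix n n ℂ →ₗ[ℂ] Matrix n' n' ℂ)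
    (X : Matrix m m ℂ) (Y : Matrix n n ℂ) :
    tensorMap E F (X ⊗ₖ Y) = E X ⊗ₖ F Y := by
  have key : ∀ (G : Matrix m m ℂ →ₗ[ℂ] Matrix m' m' ℂ) (Z : Matrix m m ℂ),
      G Z = ∑ i, ∑ j, Z i j • G (Matrix.single i j 1) := by
    intro G Z
    conv_lhs => rw [Matrix.matrix_eq_sum_single Z]
    simp only [map_sum]
    refine Finset.sum_congr rfl fun i _ => Finset.sum_congr rfl fun j _ => ?_
    rw [← LinearMap.map_smul, Matrix.smul_single, smul_eq_mul, mul_one]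
  have key' : ∀ (G : Matrix n n ℂ →ₗ[ℂ] Matrix n' n' ℂ) (Z : Matrix n n ℂ),
      G Z = ∑ i, ∑ j, Z i j • G (Matrix.single i j 1) := by
    intro G Z
    conv_lhs => rw [Matrix.matrix_eq_sum_single Z]
    simp only [map_sum]
    refine Finset.sum_congr rfl fun i _ => Finset.sum_congr rfl fun j _ => ?_
    rw [← LinearMap.map_smul, Matrix.smul_single, smul_eq_mul, mul_one]
  rw [key E X, key' F Y]
  ext ⟨a, b⟩ ⟨c, d⟩
  simp only [tensorMap, LinearMap.coe_mk, AddHom.coe_mk, Matrix.kroneckerMap_apply,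
    Matrix.sum_apply, Matrix.smul_apply, smul_eq_mul, Finset.sum_mul]
  simp only [Finset.mul_sum]
  refine Finset.sum_congr rfl fun i _ => Finset.sum_congr rfl fun j _ =>
    Finset.sum_congr rfl fun k _ => Finset.sum_congr rfl fun l _ => ?_
  ring

/-- Complete positivity: every ampliation `id ⊗ E` by a `k`-dimensional system is positive. -/
def IsCompletelyPositive {m n : Type*} [Fintype m] [DecidableEq m]
    (E : Matrix m m ℂ →ₗ[ℂ] Matrix n n ℂ) : Prop :=
  ∀ (k : ℕ) (X : Matrix (Fin k × m) (Fin k × m) ℂ), X.PosSemidef →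
    (tensorMap (LinearMap.id : Matrix (Fin k) (Fin k) ℂ →ₗ[ℂ] Matrix (Fin k) (Fin k) ℂ)
      E X).PosSemidef

/-- A quantum channel: a completely positive and trace preserving linear map. -/
structure IsChannel {m n : Type*} [Fintype m] [DecidableEq m] [Fintype n]
    (E : Matrix m m ℂ →ₗ[ℂ] Matrix n n ℂ) : Prop where
  completelyPositive : IsCompletelyPositive E
  trace_preserving : ∀ X, (E X).trace = X.trace

/-- The state of the basic triangle network: `ρb ⊗ ρc ⊗ ρa`, a state of
`C₂ A₁ | A₂ B₁ | B₂ C₁`, with the subsystems rearranged into `A₁ A₂ | B₁ B₂ | C₁ C₂`. -/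
def btnState {A₁ A₂ B₁ B₂ C₁ C₂ : Type*}
    (ρa : Matrix (B₂ × C₁) (B₂ × C₁) ℂ) (ρb : Matrix (C₂ × A₁) (C₂ × A₁) ℂ)
    (ρc : Matrix (A₂ × B₁) (A₂ × B₁) ℂ) :
    Matrix ((A₁ × A₂) × (B₁ × B₂) × (C₁ × C₂)) ((A₁ × A₂) × (B₁ × B₂) × (C₁ × C₂)) ℂ :=
  (ρb ⊗ₖ (ρc ⊗ₖ ρa)).submatrix
    (fun x => ((x.2.2.2, x.1.1), (x.1.2, x.2.1.1), (x.2.1.2, x.2.2.1)))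
    (fun x => ((x.2.2.2, x.1.1), (x.1.2, x.2.1.1), (x.2.1.2, x.2.2.1)))

/-- The state of the triangle network with local channels,
`(EA ⊗ EB ⊗ EC) (ρ_btn)`. -/
def ctnState {A₁ A₂ B₁ B₂ C₁ C₂ A B C : Type*}
    [Fintype A₁] [DecidableEq A₁] [Fintype A₂] [DecidableEq A₂]
    [Fintype B₁] [DecidableEq B₁] [Fintype B₂] [DecidableEq B₂]
    [Fintype C₁] [DecidableEq C₁] [Fintype C₂] [DecidableEq C₂]
    (EA : Matrix (A₁ × A₂) (A₁ × A₂) ℂ →ₗ[ℂ] Matrix A A ℂ)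
    (EB : Matrix (B₁ × B₂) (B₁ × B₂) ℂ →ₗ[ℂ] Matrix B B ℂ)
    (EC : Matrix (C₁ × C₂) (C₁ × C₂) ℂ →ₗ[ℂ] Matrix C C ℂ)
    (ρa : Matrix (B₂ × C₁) (B₂ × C₁) ℂ) (ρb : Matrix (C₂ × A₁) (C₂ × A₁) ℂ)
    (ρc : Matrix (A₂ × B₁) (A₂ × B₁) ℂ) :
    Matrix (A × B × C) (A × B × C) ℂ :=
  tensorMap EA (tensorMap EB EC) (btnState ρa ρb ρc)

/-- The expectation value `⟨X⟩_ρ = tr (X ρ)`. -/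
def expectation {n : Type*} [Fintype n] (ρ X : Matrix n n ℂ) : ℂ := (X * ρ).trace

/-- The covariance matrix `Γ({M_i}, ρ)`, with entries `⟨M_i M_j⟩ - ⟨M_i⟩ ⟨M_j⟩`. -/
def covMatrix {n I : Type*} [Fintype n] (M : I → Matrix n n ℂ) (ρ : Matrix n n ℂ) :
    Matrix I I ℂ :=
  Matrix.of fun i j => expectation ρ (M i * M j) - expectation ρ (M i) * expectation ρ (M j)

/-- The family `{A_i ⊗ 1 ⊗ 1} ∪ {1 ⊗ B_j ⊗ 1} ∪ {1 ⊗ 1 ⊗ C_k}` of local observables. -/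
def localObs {A B C I J K : Type*} [DecidableEq A] [DecidableEq B] [DecidableEq C]
    (a : I → Matrix A A ℂ) (b : J → Matrix B B ℂ) (c : K → Matrix C C ℂ) :
    I ⊕ J ⊕ K → Matrix (A × B × C) (A × B × C) ℂ
  | .inl i => a i ⊗ₖ ((1 : Matrix B B ℂ) ⊗ₖ (1 : Matrix C C ℂ))
  | .inr (.inl j) => (1 : Matrix A A ℂ) ⊗ₖ (b j ⊗ₖ (1 : Matrix C C ℂ))
  | .inr (.inr k) => (1 : Matrix A A ℂ) ⊗ₖ ((1 : Matrix B B ℂ) ⊗ₖ c k)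

/-- The off-diagonal block `γ_E` (rows `I`, columns `J`) of a `3 × 3` block matrix. -/
def gammaE {I J K : Type*} (Γ : Matrix (I ⊕ J ⊕ K) (I ⊕ J ⊕ K) ℂ) : Matrix I J ℂ :=
  Matrix.of fun i j => Γ (.inl i) (.inr (.inl j))

/-- The off-diagonal block `γ_F` (rows `I`, columns `K`) of a `3 × 3` block matrix. -/
def gammaF {I J K : Type*} (Γ : Matrix (I ⊕ J ⊕ K) (I ⊕ J ⊕ K) ℂ) : Matrix I K ℂ :=
  Matrix.of fun i k => Γ (.inl i) (.inr (.inr k))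

/-- The off-diagonal block `γ_G` (rows `J`, columns `K`) of a `3 × 3` block matrix. -/
def gammaG {I J K : Type*} (Γ : Matrix (I ⊕ J ⊕ K) (I ⊕ J ⊕ K) ℂ) : Matrix J K ℂ :=
  Matrix.of fun j k => Γ (.inr (.inl j)) (.inr (.inr k))

/-- The `3 × 3` block matrix with the given blocks, listed row by row. -/
def block3 {I J K : Type*}
    (M₁₁ : Matrix I I ℂ) (M₁₂ : Matrix I J ℂ) (M₁₃ : Matrix I K ℂ)
    (M₂₁ : Matrix J I ℂ) (M₂₂ : Matrix J J ℂ) (M₂₃ : Matrix J K ℂ)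
    (M₃₁ : Matrix K I ℂ) (M₃₂ : Matrix K J ℂ) (M₃₃ : Matrix K K ℂ) :
    Matrix (I ⊕ J ⊕ K) (I ⊕ J ⊕ K) ℂ :=
  Matrix.fromBlocks M₁₁ (Matrix.fromCols M₁₂ M₁₃) (Matrix.fromRows M₂₁ M₃₁)
    (Matrix.fromBlocks M₂₂ M₂₃ M₃₂ M₃₃)

end

/-! Work in the Heisenberg picture, where the network state is a positive normalised functional and
each channel is replaced by its dual `D`, a unital map that satisfies the Kadison–Schwarz inequality
(`IsChannel.exists_heisenberg_dual`, from Kraus operators).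

Two parties share exactly one source. Their mutual covariance depends on their dual observables only
through the partial averages over the sources that are not shared
(`IsTriangle.covForm_AB`, `IsTriangle.covForm_AC`, `IsTriangle.covForm_BC`). The covariance matrix of
the averaged observables in the state of the shared source is positive semidefinite and has the
correct off-diagonal blocks; this gives one summand for each source.

The three summands do not exhaust the diagonal blocks of `Γ`, but what is left of each is positive
semidefinite (`residual_posSemidef`). One part of it is the Kadison–Schwarz defect
`⟨D(X Y)⟩ - ⟨D(X) D(Y)⟩`. The other comes from the fact that each party holds a product state, one
factor per source: by the analysis-of-variance identity `covForm_sub_averages`, the covariance minus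
the covariances of the two partial averages is the covariance of the observables with these averages
removed. The residual of each party can be added to either of its two summands. -/

/-! ### Positive functionals and Schwarz maps -/

/-- A state in the Heisenberg picture: a normalised positive linear functional on a matrix
algebra. Compatibility with the adjoint follows from positivity; it is kept as a field because it
is immediate for every functional used here. -/
structure IsExpectation {n : Type*} [Fintype n] [DecidableEq n]
    (f : Matrix n n ℂ →ₗ[ℂ] ℂ) : Prop where
  map_one : f 1 = 1
  map_conjTranspose : ∀ X, f Xᴴ = star (f X)
  nonneg : ∀ X, 0 ≤ f (Xᴴ * X)

/-- A unital, adjoint-preserving linear map `D` between matrix algebras that satisfies the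
Kadison–Schwarz inequality `D(X)ᴴ D(X) ≤ D(Xᴴ X)` for all, not only normal, `X`. -/
structure IsSchwarzMap {m n : Type*} [Fintype m] [DecidableEq m] [Fintype n] [DecidableEq n]
    (D : Matrix n n ℂ →ₗ[ℂ] Matrix m m ℂ) : Prop where
  map_one : D 1 = 1
  map_conjTranspose : ∀ X, D Xᴴ = (D X)ᴴ
  schwarz : ∀ X, (D (Xᴴ * X) - (D X)ᴴ * D X).PosSemidef

theorem IsExpectation.nonneg_of_posSemidef {n : Type*} [Fintype n] [DecidableEq n]
    {f : Matrix n n ℂ →ₗ[ℂ] ℂ} (hf : IsExpectation f) {X : Matrix n n ℂ} (hX : X.PosSemidef) :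
    0 ≤ f X := by
  open scoped MatrixOrder Matrix.Norms.L2Operator in
  obtain ⟨B, rfl⟩ := CStarAlgebra.nonneg_iff_eq_star_mul_self.mp hX.nonneg
  exact hf.nonneg B

/-- The functional `X ↦ tr (X ρ)`. -/
noncomputable def expectationLM {n : Type*} [Fintype n] (ρ : Matrix n n ℂ) :
    Matrix n n ℂ →ₗ[ℂ] ℂ :=
  Matrix.traceLinearMap n ℂ ℂ ∘ₗ LinearMap.mulRight ℂ ρ

theorem expectationLM_apply {n : Type*} [Fintype n] (ρ X : Matrix n n ℂ) :
    expectationLM ρ X = (X * ρ).trace := rfl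

theorem IsState.isExpectation {n : Type*} [Fintype n] [DecidableEq n] {ρ : Matrix n n ℂ}
    (hρ : IsState ρ) : IsExpectation (expectationLM ρ) where
  map_one := by rw [expectationLM_apply, one_mul, hρ.trace_eq_one]
  map_conjTranspose X := by
    rw [expectationLM_apply, expectationLM_apply, ← Matrix.trace_conjTranspose,
      Matrix.conjTranspose_mul, hρ.posSemidef.isHermitian.eq, Matrix.trace_mul_comm]
  nonneg X := by
    rw [expectationLM_apply, mul_assoc, Matrix.trace_mul_comm]
    exact (hρ.posSemidef.mul_mul_conjTranspose_same X).trace_nonneg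

/-- The Gram matrix of Hermitian matrices with respect to a positive sesquilinear form
`(X, Y) ↦ s Xᴴ Y`, presented as the bilinear map `s`, is positive semidefinite. -/
theorem gram_posSemidef {n I : Type*} [Finite I]
    (s : Matrix n n ℂ →ₗ[ℂ] Matrix n n ℂ →ₗ[ℂ] ℂ)
    (hherm : ∀ X Y, s Xᴴ Yᴴ = star (s Y X)) (hpos : ∀ X, 0 ≤ s Xᴴ X)
    (a : I → Matrix n n ℂ) (ha : ∀ i, (a i).IsHermitian) :
    (Matrix.of fun i j => s (a i) (a j)).PosSemidef := by
  have := Fintype.ofFinite I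
  refine Matrix.PosSemidef.of_dotProduct_mulVec_nonneg ?_ fun x => ?_
  · ext i j
    rw [Matrix.conjTranspose_apply, Matrix.of_apply, Matrix.of_apply, ← hherm, (ha i).eq,
      (ha j).eq]
  · convert hpos (∑ i, x i • a i) using 1
    simp only [Matrix.conjTranspose_sum, Matrix.conjTranspose_smul, (ha _).eq, map_sum, map_smul,
      LinearMap.sum_apply, LinearMap.smul_apply, dotProduct, Matrix.mulVec, Matrix.of_apply,
      Pi.star_apply, smul_eq_mul, Finset.mul_sum]
    rw [Finset.sum_comm]
    exact Finset.sum_congr rfl fun j _ => Finset.sum_congr rfl fun i _ => by ring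

/-- The covariance form `(X, Y) ↦ f (X Y) - f X f Y` of a functional. -/
noncomputable def covForm {n : Type*} [Fintype n] [DecidableEq n]
    (f : Matrix n n ℂ →ₗ[ℂ] ℂ) : Matrix n n ℂ →ₗ[ℂ] Matrix n n ℂ →ₗ[ℂ] ℂ :=
  (LinearMap.mul ℂ (Matrix n n ℂ)).compr₂ f - (LinearMap.mul ℂ ℂ).compl₁₂ f f

theorem covForm_apply {n : Type*} [Fintype n] [DecidableEq n]
    (f : Matrix n n ℂ →ₗ[ℂ] ℂ) (X Y : Matrix n n ℂ) :
    covForm f X Y = f (X * Y) - f X * f Y := by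
  simp [covForm]

theorem IsExpectation.covForm_posSemidef {n I : Type*} [Fintype n] [DecidableEq n] [Finite I]
    {f : Matrix n n ℂ →ₗ[ℂ] ℂ} (hf : IsExpectation f)
    (a : I → Matrix n n ℂ) (ha : ∀ i, (a i).IsHermitian) :
    (Matrix.of fun i j => covForm f (a i) (a j)).PosSemidef := by
  refine gram_posSemidef _ (fun X Y => ?_) (fun X => ?_) a ha
  · simp only [covForm_apply, ← Matrix.conjTranspose_mul, hf.map_conjTranspose, star_sub, star_mul]
  · -- The variance is the second moment of the centred variable `X - f X`.
    convert hf.nonneg (X - f X • 1) using 1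
    simp only [covForm_apply, Matrix.conjTranspose_sub, Matrix.conjTranspose_smul,
      Matrix.conjTranspose_one, sub_mul, mul_sub, map_sub, map_smul, smul_mul_assoc,
      mul_smul_comm, one_mul, mul_one, hf.map_conjTranspose, hf.map_one, smul_eq_mul]
    ring

/-- The defect `f (D (X Y)) - f (D X D Y)` of multiplicativity of a map `D`, in mean. -/
noncomputable def schwarzForm {m n : Type*} [Fintype m] [DecidableEq m] [Fintype n]
    [DecidableEq n] (f : Matrix m m ℂ →ₗ[ℂ] ℂ) (D : Matrix n n ℂ →ₗ[ℂ] Matrix m m ℂ) :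
    Matrix n n ℂ →ₗ[ℂ] Matrix n n ℂ →ₗ[ℂ] ℂ :=
  (LinearMap.mul ℂ (Matrix n n ℂ)).compr₂ (f ∘ₗ D)
    - ((LinearMap.mul ℂ (Matrix m m ℂ)).compl₁₂ D D).compr₂ f

theorem schwarzForm_apply {m n : Type*} [Fintype m] [DecidableEq m] [Fintype n]
    [DecidableEq n] (f : Matrix m m ℂ →ₗ[ℂ] ℂ) (D : Matrix n n ℂ →ₗ[ℂ] Matrix m m ℂ)
    (X Y : Matrix n n ℂ) : schwarzForm f D X Y = f (D (X * Y)) - f (D X * D Y) := by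
  simp [schwarzForm]

theorem IsSchwarzMap.schwarzForm_posSemidef {m n I : Type*} [Fintype m] [DecidableEq m]
    [Fintype n] [DecidableEq n] [Finite I] {f : Matrix m m ℂ →ₗ[ℂ] ℂ} (hf : IsExpectation f)
    {D : Matrix n n ℂ →ₗ[ℂ] Matrix m m ℂ} (hD : IsSchwarzMap D)
    (a : I → Matrix n n ℂ) (ha : ∀ i, (a i).IsHermitian) :
    (Matrix.of fun i j => schwarzForm f D (a i) (a j)).PosSemidef := by
  refine gram_posSemidef _ (fun X Y => ?_) (fun X => ?_) a ha
  · simp only [schwarzForm_apply, ← Matrix.conjTranspose_mul, hf.map_conjTranspose,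
      hD.map_conjTranspose, star_sub]
  · rw [schwarzForm_apply, hD.map_conjTranspose, ← map_sub]
    exact hf.nonneg_of_posSemidef (hD.schwarz X)

/-! ### Kraus operators and the Heisenberg picture of a channel -/

/-- A completely positive map has Kraus operators: they are read off from a factorisation
`Bᴴ * B` of the Choi matrix, the image of the unnormalised maximally entangled state. -/
theorem IsCompletelyPositive.exists_kraus {m n : Type*} [Fintype m] [DecidableEq m] [Fintype n]
    {E : Matrix m m ℂ →ₗ[ℂ] Matrix n n ℂ} (hE : IsCompletelyPositive E) :
    ∃ V : Fin (Fintype.card m) × n → Matrix n m ℂ, ∀ X, E X = ∑ κ, V κ * X * (V κ)ᴴ := by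
  classical
  let e := Fintype.equivFin m
  let w : Fin (Fintype.card m) × m → ℂ := fun p => if p.1 = e p.2 then 1 else 0
  have hΩ : Matrix.vecMulVec w (star w) =
      ∑ i, ∑ j, Matrix.single (e i) (e j) (1 : ℂ) ⊗ₖ Matrix.single i j (1 : ℂ) := by
    ext ⟨p, k⟩ ⟨q, l⟩
    simp only [Matrix.vecMulVec_apply, Pi.star_apply, w, Matrix.sum_apply,
      Matrix.single_kronecker_single, Matrix.single_apply, Prod.mk.injEq, mul_one]
    simp only [apply_ite star, star_one, star_zero, ite_and]
    rw [Finset.sum_eq_single k, Finset.sum_eq_single l]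
    · by_cases h1 : p = e k <;> simp [h1, eq_comm]
    · intro j _ hj; simp [hj]
    · simp
    · intro i _ hi; simp [hi]
    · simp
  have hC := hE _ _ (Matrix.posSemidef_vecMulVec_self_star w)
  rw [hΩ] at hC
  simp only [map_sum, tensorMap_kronecker, LinearMap.id_apply] at hC
  obtain ⟨B, hB⟩ : ∃ B : Matrix (Fin (Fintype.card m) × n) (Fin (Fintype.card m) × n) ℂ,
      ∑ i, ∑ j, Matrix.single (e i) (e j) (1 : ℂ) ⊗ₖ E (Matrix.single i j 1) = Bᴴ * B := by
    open scoped MatrixOrder Matrix.Norms.L2Operator in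
    exact CStarAlgebra.nonneg_iff_eq_star_mul_self.mp hC.nonneg
  have hunit : ∀ i j x y, E (Matrix.single i j 1) x y =
      ∑ κ, star (B κ (e i, x)) * B κ (e j, y) := by
    intro i j x y
    have h := congrFun (congrFun hB (e i, x)) (e j, y)
    rw [Matrix.mul_apply] at h
    simp only [Matrix.conjTranspose_apply] at h
    rw [← h]
    simp only [Matrix.sum_apply, Matrix.kroneckerMap_apply, Matrix.single_apply,
      EmbeddingLike.apply_eq_iff_eq, ite_and, ite_mul, one_mul, zero_mul]
    simp
  refine ⟨fun κ => Matrix.of fun x i => star (B κ (e i, x)), fun X => ?_⟩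
  ext x y
  conv_lhs => rw [Matrix.matrix_eq_sum_single X]
  have hsm : ∀ i j, Matrix.single i j (X i j) = X i j • Matrix.single i j (1 : ℂ) := by
    intro i j; rw [Matrix.smul_single, smul_eq_mul, mul_one]
  simp only [hsm, map_sum, map_smul, Matrix.sum_apply, Matrix.smul_apply, hunit, smul_eq_mul,
    Matrix.mul_apply, Matrix.conjTranspose_apply, Matrix.of_apply, star_star, Finset.sum_mul,
    Finset.mul_sum]
  rw [Finset.sum_comm]
  simp_rw [Finset.sum_comm (s := (Finset.univ : Finset m))
    (t := (Finset.univ : Finset (Fin (Fintype.card m) × n)))]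
  refine Finset.sum_congr rfl fun κ _ => Finset.sum_congr rfl fun j _ =>
    Finset.sum_congr rfl fun i _ => ?_
  ring

/-- The Heisenberg dual of a channel: a Schwarz map `D` with `tr (A E(X)) = tr (D(A) X)`.
With Kraus operators `V κ` it is `D(A) = ∑ κ, (V κ)ᴴ A (V κ)`, and
`D(Aᴴ A) - D(A)ᴴ D(A) = ∑ κ, (A V κ - V κ D(A))ᴴ (A V κ - V κ D(A))`. -/
theorem IsChannel.exists_heisenberg_dual {m n : Type*} [Fintype m] [DecidableEq m] [Fintype n]
    [DecidableEq n] {E : Matrix m m ℂ →ₗ[ℂ] Matrix n n ℂ} (hE : IsChannel E) :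
    ∃ D : Matrix n n ℂ →ₗ[ℂ] Matrix m m ℂ, IsSchwarzMap D ∧
      ∀ A X, (A * E X).trace = (D A * X).trace := by
  obtain ⟨V, hV⟩ := hE.completelyPositive.exists_kraus
  let D : Matrix n n ℂ →ₗ[ℂ] Matrix m m ℂ :=
    { toFun := fun A => ∑ κ, (V κ)ᴴ * A * V κ
      map_add' := fun A B => by
        simp only [Matrix.mul_add, Matrix.add_mul, Finset.sum_add_distrib]
      map_smul' := fun c A => by
        simp only [Matrix.mul_smul, Matrix.smul_mul, Finset.smul_sum, RingHom.id_apply] }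
  have hD : ∀ A, D A = ∑ κ, (V κ)ᴴ * A * V κ := fun _ => rfl
  have hdual : ∀ A X, (A * E X).trace = (D A * X).trace := by
    intro A X
    rw [hV, hD, Matrix.mul_sum, Matrix.sum_mul, Matrix.trace_sum, Matrix.trace_sum]
    refine Finset.sum_congr rfl fun κ _ => ?_
    rw [← Matrix.mul_assoc, Matrix.trace_mul_comm]
    simp only [Matrix.mul_assoc]
  have hone : D 1 = 1 := by
    rw [Matrix.ext_iff_trace_mul_right]
    intro X
    rw [← hdual, one_mul, one_mul, hE.trace_preserving]
  have hstar : ∀ A, D Aᴴ = (D A)ᴴ := by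
    intro A
    simp only [hD, Matrix.conjTranspose_sum, Matrix.conjTranspose_mul,
      Matrix.conjTranspose_conjTranspose, Matrix.mul_assoc]
  refine ⟨D, ⟨hone, hstar, fun A => ?_⟩, hdual⟩
  have hone' : ∑ κ, (V κ)ᴴ * V κ = 1 := by simpa [hD] using hone
  have key : D (Aᴴ * A) - (D A)ᴴ * D A =
      ∑ κ, (A * V κ - V κ * D A)ᴴ * (A * V κ - V κ * D A) := by
    have h1 : ∑ κ, (D A)ᴴ * ((V κ)ᴴ * A * V κ) = (D A)ᴴ * D A := by
      rw [← Matrix.mul_sum, ← hD]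
    have h2 : ∑ κ, ((V κ)ᴴ * Aᴴ * V κ) * D A = (D A)ᴴ * D A := by
      rw [← Matrix.sum_mul, ← hD, hstar]
    have h3 : ∑ κ, (D A)ᴴ * ((V κ)ᴴ * V κ) * D A = (D A)ᴴ * D A := by
      rw [← Matrix.sum_mul, ← Matrix.mul_sum, hone', mul_one]
    have h4 : ∑ κ, (V κ)ᴴ * (Aᴴ * A) * V κ = D (Aᴴ * A) := (hD _).symm
    simp only [Matrix.mul_assoc] at h1 h2 h3 h4
    simp only [Matrix.conjTranspose_sub, Matrix.conjTranspose_mul, Matrix.sub_mul,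
      Matrix.mul_sub, Finset.sum_sub_distrib, Matrix.mul_assoc, h1, h2, h3, h4]
    abel
  rw [key]
  exact Matrix.posSemidef_sum _ fun κ _ => Matrix.posSemidef_conjTranspose_mul_self _

/-! ### Functionals and partial averages on tensor products -/

theorem Matrix.IsHermitian.kronecker_one {m n : Type*} [DecidableEq n] {X : Matrix m m ℂ}
    (hX : X.IsHermitian) : (X ⊗ₖ (1 : Matrix n n ℂ)).IsHermitian := by
  rw [Matrix.IsHermitian, Matrix.conjTranspose_kronecker, Matrix.conjTranspose_one, hX.eq]

theorem Matrix.IsHermitian.one_kronecker {m n : Type*} [DecidableEq m] {X : Matrix n n ℂ}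
    (hX : X.IsHermitian) : ((1 : Matrix m m ℂ) ⊗ₖ X).IsHermitian := by
  rw [Matrix.IsHermitian, Matrix.conjTranspose_kronecker, Matrix.conjTranspose_one, hX.eq]

/-- Linear maps on `M_m ⊗ M_n` that agree on product matrices are equal. -/
theorem linearMap_ext_kronecker {m n V : Type*} [Fintype m] [DecidableEq m] [Fintype n]
    [DecidableEq n] [AddCommGroup V] [Module ℂ V] {F G : Matrix (m × n) (m × n) ℂ →ₗ[ℂ] V}
    (h : ∀ (p : Matrix m m ℂ) (q : Matrix n n ℂ), F (p ⊗ₖ q) = G (p ⊗ₖ q)) : F = G := by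
  refine Matrix.ext_linearMap _ fun i j => LinearMap.ext_ring ?_
  simpa [Matrix.single_kronecker_single] using h (Matrix.single i.1 j.1 1) (Matrix.single i.2 j.2 1)

/-- The linear map `X ↦ X ⊗ Y`. -/
noncomputable def kronRight {m n : Type*} (Y : Matrix n n ℂ) :
    Matrix m m ℂ →ₗ[ℂ] Matrix (m × n) (m × n) ℂ where
  toFun X := X ⊗ₖ Y
  map_add' X X' := Matrix.add_kronecker X X' Y
  map_smul' c X := Matrix.smul_kronecker c X Y

/-- The linear map `Y ↦ X ⊗ Y`. -/
noncomputable def kronLeft {m n : Type*} (X : Matrix m m ℂ) :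
    Matrix n n ℂ →ₗ[ℂ] Matrix (m × n) (m × n) ℂ where
  toFun Y := X ⊗ₖ Y
  map_add' Y Y' := Matrix.kronecker_add X Y Y'
  map_smul' c Y := Matrix.kronecker_smul c X Y

@[simp] theorem kronRight_apply {m n : Type*} (X : Matrix m m ℂ) (Y : Matrix n n ℂ) :
    kronRight Y X = X ⊗ₖ Y := rfl

@[simp] theorem kronLeft_apply {m n : Type*} (X : Matrix m m ℂ) (Y : Matrix n n ℂ) :
    kronLeft X Y = X ⊗ₖ Y := rfl

/-- The partial average `f ⊗ id` over the first tensor factor. -/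
noncomputable def averageLeft {m n : Type*} (f : Matrix m m ℂ →ₗ[ℂ] ℂ) :
    Matrix (m × n) (m × n) ℂ →ₗ[ℂ] Matrix n n ℂ where
  toFun X := Matrix.of fun k l => f (Matrix.of fun i j => X (i, k) (j, l))
  map_add' X Y := by ext k l; exact map_add f _ _
  map_smul' c X := by ext k l; exact map_smul f c _

/-- The partial average `id ⊗ g` over the second tensor factor. -/
noncomputable def averageRight {m n : Type*} (g : Matrix n n ℂ →ₗ[ℂ] ℂ) :
    Matrix (m × n) (m × n) ℂ →ₗ[ℂ] Matrix m m ℂ where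
  toFun X := Matrix.of fun i j => g (Matrix.of fun k l => X (i, k) (j, l))
  map_add' X Y := by ext i j; exact map_add g _ _
  map_smul' c X := by ext i j; exact map_smul g c _

@[simp] theorem averageLeft_kronecker {m n : Type*} (f : Matrix m m ℂ →ₗ[ℂ] ℂ)
    (p : Matrix m m ℂ) (q : Matrix n n ℂ) : averageLeft f (p ⊗ₖ q) = f p • q := by
  ext k l
  have : (Matrix.of fun i j => (p ⊗ₖ q) (i, k) (j, l)) = q k l • p := by
    ext i j; simp [mul_comm]
  change f (Matrix.of fun i j => (p ⊗ₖ q) (i, k) (j, l)) = _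
  rw [this, map_smul, Matrix.smul_apply, smul_eq_mul, smul_eq_mul, mul_comm]

@[simp] theorem averageRight_kronecker {m n : Type*} (g : Matrix n n ℂ →ₗ[ℂ] ℂ)
    (p : Matrix m m ℂ) (q : Matrix n n ℂ) : averageRight g (p ⊗ₖ q) = g q • p := by
  ext i j
  have : (Matrix.of fun k l => (p ⊗ₖ q) (i, k) (j, l)) = p i j • q := by
    ext k l; simp
  change g (Matrix.of fun k l => (p ⊗ₖ q) (i, k) (j, l)) = _
  rw [this, map_smul, Matrix.smul_apply, smul_eq_mul, smul_eq_mul, mul_comm]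

theorem IsExpectation.averageLeft_isHermitian {m n : Type*} [Fintype m] [DecidableEq m]
    {f : Matrix m m ℂ →ₗ[ℂ] ℂ} (hf : IsExpectation f) {X : Matrix (m × n) (m × n) ℂ}
    (hX : X.IsHermitian) : (averageLeft f X).IsHermitian := by
  ext k l
  change star (f _) = f _
  rw [← hf.map_conjTranspose]
  congr 1
  ext i j
  exact hX.apply (i, k) (j, l)

theorem IsExpectation.averageRight_isHermitian {m n : Type*} [Fintype n] [DecidableEq n]
    {g : Matrix n n ℂ →ₗ[ℂ] ℂ} (hg : IsExpectation g) {X : Matrix (m × n) (m × n) ℂ}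
    (hX : X.IsHermitian) : (averageRight g X).IsHermitian := by
  ext i j
  change star (g _) = g _
  rw [← hg.map_conjTranspose]
  congr 1
  ext k l
  exact hX.apply (i, k) (j, l)

theorem IsExpectation.comp_kronRight {m n : Type*} [Fintype m] [DecidableEq m] [Fintype n]
    [DecidableEq n] {φ : Matrix (m × n) (m × n) ℂ →ₗ[ℂ] ℂ} (hφ : IsExpectation φ) :
    IsExpectation (φ ∘ₗ (kronRight 1 : Matrix m m ℂ →ₗ[ℂ] _)) where
  map_one := by simp [hφ.map_one]
  map_conjTranspose X := by
    simp [← hφ.map_conjTranspose, Matrix.conjTranspose_kronecker]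
  nonneg X := by
    have h := hφ.nonneg (X ⊗ₖ 1)
    rw [Matrix.conjTranspose_kronecker, ← Matrix.mul_kronecker_mul, Matrix.conjTranspose_one,
      mul_one] at h
    exact h

theorem IsExpectation.comp_kronLeft {m n : Type*} [Fintype m] [DecidableEq m] [Fintype n]
    [DecidableEq n] {φ : Matrix (m × n) (m × n) ℂ →ₗ[ℂ] ℂ} (hφ : IsExpectation φ) :
    IsExpectation (φ ∘ₗ (kronLeft 1 : Matrix n n ℂ →ₗ[ℂ] _)) where
  map_one := by simp [hφ.map_one]
  map_conjTranspose X := by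
    simp [← hφ.map_conjTranspose, Matrix.conjTranspose_kronecker]
  nonneg X := by
    have h := hφ.nonneg (1 ⊗ₖ X)
    rw [Matrix.conjTranspose_kronecker, ← Matrix.mul_kronecker_mul, Matrix.conjTranspose_one,
      mul_one] at h
    exact h

/-! ### The covariance of local observables in a product state -/

section product

variable {m n : Type*} [Fintype m] [DecidableEq m] [Fintype n] [DecidableEq n]
  {f : Matrix m m ℂ →ₗ[ℂ] ℂ} {g : Matrix n n ℂ →ₗ[ℂ] ℂ}
  {h : Matrix (m × n) (m × n) ℂ →ₗ[ℂ] ℂ}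

theorem apply_mul_one_kronecker (hfg : ∀ p q, h (p ⊗ₖ q) = f p * g q)
    (X : Matrix (m × n) (m × n) ℂ) (q : Matrix n n ℂ) :
    h (X * (1 ⊗ₖ q)) = g (averageLeft f X * q) := by
  refine LinearMap.congr_fun (f := h ∘ₗ LinearMap.mulRight ℂ (1 ⊗ₖ q))
    (g := g ∘ₗ LinearMap.mulRight ℂ q ∘ₗ averageLeft f) (linearMap_ext_kronecker fun p r => ?_) X
  simp [← Matrix.mul_kronecker_mul, hfg]

theorem apply_one_kronecker_mul (hfg : ∀ p q, h (p ⊗ₖ q) = f p * g q)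
    (X : Matrix (m × n) (m × n) ℂ) (q : Matrix n n ℂ) :
    h ((1 ⊗ₖ q) * X) = g (q * averageLeft f X) := by
  refine LinearMap.congr_fun (f := h ∘ₗ LinearMap.mulLeft ℂ (1 ⊗ₖ q))
    (g := g ∘ₗ LinearMap.mulLeft ℂ q ∘ₗ averageLeft f) (linearMap_ext_kronecker fun p r => ?_) X
  simp [← Matrix.mul_kronecker_mul, hfg]

theorem apply_mul_kronecker_one (hfg : ∀ p q, h (p ⊗ₖ q) = f p * g q)
    (X : Matrix (m × n) (m × n) ℂ) (p : Matrix m m ℂ) :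
    h (X * (p ⊗ₖ 1)) = f (averageRight g X * p) := by
  refine LinearMap.congr_fun (f := h ∘ₗ LinearMap.mulRight ℂ (p ⊗ₖ 1))
    (g := f ∘ₗ LinearMap.mulRight ℂ p ∘ₗ averageRight g) (linearMap_ext_kronecker fun p r => ?_) X
  simp [← Matrix.mul_kronecker_mul, hfg, mul_comm]

theorem apply_kronecker_one_mul (hfg : ∀ p q, h (p ⊗ₖ q) = f p * g q)
    (X : Matrix (m × n) (m × n) ℂ) (p : Matrix m m ℂ) :
    h ((p ⊗ₖ 1) * X) = f (p * averageRight g X) := by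
  refine LinearMap.congr_fun (f := h ∘ₗ LinearMap.mulLeft ℂ (p ⊗ₖ 1))
    (g := f ∘ₗ LinearMap.mulLeft ℂ p ∘ₗ averageRight g) (linearMap_ext_kronecker fun p r => ?_) X
  simp [← Matrix.mul_kronecker_mul, hfg, mul_comm]

/-- The analysis-of-variance identity for a product state: removing from each observable its
partial averages over either factor subtracts the covariances of these averages. -/
theorem covForm_sub_averages (hf : f 1 = 1) (hg : g 1 = 1)
    (hfg : ∀ p q, h (p ⊗ₖ q) = f p * g q) (X Y : Matrix (m × n) (m × n) ℂ) :
    covForm h (X - 1 ⊗ₖ averageLeft f X - averageRight g X ⊗ₖ 1)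
        (Y - 1 ⊗ₖ averageLeft f Y - averageRight g Y ⊗ₖ 1) =
      covForm h X Y - covForm g (averageLeft f X) (averageLeft f Y)
        - covForm f (averageRight g X) (averageRight g Y) := by
  have hl : ∀ X, h X = g (averageLeft f X) := fun X => by
    simpa using apply_mul_one_kronecker hfg X 1
  have hr : ∀ X, h X = f (averageRight g X) := fun X => by
    simpa using apply_mul_kronecker_one hfg X 1
  rw [covForm_apply, covForm_apply, covForm_apply, covForm_apply]
  simp only [sub_mul, mul_sub, map_sub, apply_mul_one_kronecker hfg,
    apply_one_kronecker_mul hfg, apply_mul_kronecker_one hfg, apply_kronecker_one_mul hfg,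
    ← Matrix.mul_kronecker_mul, one_mul, mul_one, hfg, hf, hg]
  rw [← hl X, ← hl Y, ← hr X, ← hr Y]
  ring

/-- The part of the local covariance matrix, after the Schwarz map `D`, that is not accounted for
by the two partial averages is positive semidefinite: it is the sum of the Schwarz defect of `D`
and of the covariance matrix of the observables with their partial averages removed. -/
theorem residual_posSemidef {k I : Type*} [Fintype k] [DecidableEq k] [Finite I]
    (hh : IsExpectation h) (hf : IsExpectation f) (hg : IsExpectation g)
    (hfg : ∀ p q, h (p ⊗ₖ q) = f p * g q) {D : Matrix k k ℂ →ₗ[ℂ] Matrix (m × n) (m × n) ℂ}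
    (hD : IsSchwarzMap D) (a : I → Matrix k k ℂ) (ha : ∀ i, (a i).IsHermitian) :
    (Matrix.of fun i j => h (D (a i * a j)) - h (D (a i)) * h (D (a j))
      - covForm g (averageLeft f (D (a i))) (averageLeft f (D (a j)))
      - covForm f (averageRight g (D (a i))) (averageRight g (D (a j)))).PosSemidef := by
  have hDa : ∀ i, (D (a i)).IsHermitian := fun i => by
    rw [Matrix.IsHermitian, ← hD.map_conjTranspose, (ha i).eq]
  have h1 := hD.schwarzForm_posSemidef hh a ha
  have h2 := hh.covForm_posSemidef
    (fun i => D (a i) - 1 ⊗ₖ averageLeft f (D (a i)) - averageRight g (D (a i)) ⊗ₖ 1) fun i =>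
      ((hDa i).sub (hf.averageLeft_isHermitian (hDa i)).one_kronecker).sub
        (hg.averageRight_isHermitian (hDa i)).kronecker_one
  convert h1.add h2 using 1
  ext i j
  rw [Matrix.add_apply, Matrix.of_apply, Matrix.of_apply, Matrix.of_apply,
    covForm_sub_averages hf.map_one hg.map_one hfg, schwarzForm_apply, covForm_apply h]
  ring

end product

/-! ### The state of the triangle network -/

theorem IsState.kronecker {m n : Type*} [Fintype m] [Fintype n] {ρ : Matrix m m ℂ}
    {σ : Matrix n n ℂ} (hρ : IsState ρ) (hσ : IsState σ) : IsState (ρ ⊗ₖ σ) where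
  posSemidef := hρ.posSemidef.kronecker hσ.posSemidef
  trace_eq_one := by rw [Matrix.trace_kronecker, hρ.trace_eq_one, hσ.trace_eq_one, one_mul]

theorem trace_submatrix_equiv {m n : Type*} [Fintype m] [Fintype n] (e : m ≃ n)
    (X : Matrix n n ℂ) : (X.submatrix e e).trace = X.trace :=
  e.sum_comp fun i => X i i

/-- The rearrangement `A₁ A₂ | B₁ B₂ | C₁ C₂ → C₂ A₁ | A₂ B₁ | B₂ C₁` of subsystems. -/
def btnEquiv (A₁ A₂ B₁ B₂ C₁ C₂ : Type*) :
    (A₁ × A₂) × (B₁ × B₂) × (C₁ × C₂) ≃ (C₂ × A₁) × (A₂ × B₁) × (B₂ × C₁) where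
  toFun x := ((x.2.2.2, x.1.1), (x.1.2, x.2.1.1), (x.2.1.2, x.2.2.1))
  invFun y := ((y.1.2, y.2.1.1), (y.2.1.2, y.2.2.1), (y.2.2.2, y.1.1))
  left_inv _ := rfl
  right_inv _ := rfl

section btn

variable {A₁ A₂ B₁ B₂ C₁ C₂ : Type*}
  [Fintype A₁] [Fintype A₂] [Fintype B₁] [Fintype B₂] [Fintype C₁] [Fintype C₂]
  {ρa : Matrix (B₂ × C₁) (B₂ × C₁) ℂ} {ρb : Matrix (C₂ × A₁) (C₂ × A₁) ℂ}
  {ρc : Matrix (A₂ × B₁) (A₂ × B₁) ℂ}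

theorem IsState.btnState (ha : IsState ρa) (hb : IsState ρb) (hc : IsState ρc) :
    IsState (btnState ρa ρb ρc) where
  posSemidef := (hb.kronecker (hc.kronecker ha)).posSemidef.submatrix _
  trace_eq_one := (trace_submatrix_equiv (btnEquiv A₁ A₂ B₁ B₂ C₁ C₂) _).trans
    (hb.kronecker (hc.kronecker ha)).trace_eq_one

theorem expectationLM_btnState (ρa : Matrix (B₂ × C₁) (B₂ × C₁) ℂ)
    (ρb : Matrix (C₂ × A₁) (C₂ × A₁) ℂ) (ρc : Matrix (A₂ × B₁) (A₂ × B₁) ℂ)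
    (p₁ : Matrix A₁ A₁ ℂ) (p₂ : Matrix A₂ A₂ ℂ)
    (q₁ : Matrix B₁ B₁ ℂ) (q₂ : Matrix B₂ B₂ ℂ) (r₁ : Matrix C₁ C₁ ℂ) (r₂ : Matrix C₂ C₂ ℂ) :
    expectationLM (_root_.btnState ρa ρb ρc) ((p₁ ⊗ₖ p₂) ⊗ₖ ((q₁ ⊗ₖ q₂) ⊗ₖ (r₁ ⊗ₖ r₂))) =
      expectationLM ρb (r₂ ⊗ₖ p₁) * expectationLM ρc (p₂ ⊗ₖ q₁) * expectationLM ρa (q₂ ⊗ₖ r₁) := by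
  have h : (p₁ ⊗ₖ p₂) ⊗ₖ ((q₁ ⊗ₖ q₂) ⊗ₖ (r₁ ⊗ₖ r₂)) =
      ((r₂ ⊗ₖ p₁) ⊗ₖ ((p₂ ⊗ₖ q₁) ⊗ₖ (q₂ ⊗ₖ r₁))).submatrix (btnEquiv A₁ A₂ B₁ B₂ C₁ C₂)
        (btnEquiv A₁ A₂ B₁ B₂ C₁ C₂) := by
    ext x y
    simp only [btnEquiv, Matrix.kroneckerMap_apply, Matrix.submatrix_apply, Equiv.coe_fn_mk]
    ring
  have h' : _root_.btnState ρa ρb ρc = (ρb ⊗ₖ (ρc ⊗ₖ ρa)).submatrix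
      (btnEquiv A₁ A₂ B₁ B₂ C₁ C₂) (btnEquiv A₁ A₂ B₁ B₂ C₁ C₂) := rfl
  rw [expectationLM_apply, h, h', Matrix.submatrix_mul_equiv, trace_submatrix_equiv,
    ← Matrix.mul_kronecker_mul, ← Matrix.mul_kronecker_mul, Matrix.trace_kronecker,
    Matrix.trace_kronecker, mul_assoc]
  rfl

end btn

/-- The Heisenberg dual of a tensor product of maps is the tensor product of the duals. -/
theorem trace_kronecker_mul_tensorMap {m m' n n' : Type*} [Fintype m] [DecidableEq m]
    [Fintype n] [DecidableEq n] [Fintype m'] [Fintype n']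
    {E : Matrix m m ℂ →ₗ[ℂ] Matrix m' m' ℂ} {F : Matrix n n ℂ →ₗ[ℂ] Matrix n' n' ℂ}
    {x : Matrix m' m' ℂ} {x' : Matrix m m ℂ} {y : Matrix n' n' ℂ} {y' : Matrix n n ℂ}
    (hx : ∀ X, (x * E X).trace = (x' * X).trace) (hy : ∀ Y, (y * F Y).trace = (y' * Y).trace)
    (Z : Matrix (m × n) (m × n) ℂ) :
    ((x ⊗ₖ y) * tensorMap E F Z).trace = ((x' ⊗ₖ y') * Z).trace := by
  refine LinearMap.congr_fun
    (f := Matrix.traceLinearMap _ ℂ ℂ ∘ₗ LinearMap.mulLeft ℂ (x ⊗ₖ y) ∘ₗ tensorMap E F)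
    (g := Matrix.traceLinearMap _ ℂ ℂ ∘ₗ LinearMap.mulLeft ℂ (x' ⊗ₖ y'))
    (linearMap_ext_kronecker fun p q => ?_) Z
  simp only [LinearMap.comp_apply, LinearMap.mulLeft_apply, Matrix.traceLinearMap_apply,
    tensorMap_kronecker, ← Matrix.mul_kronecker_mul, Matrix.trace_kronecker, hx, hy]

/-! ### Covariances of two parties in a triangle -/

theorem covForm_kronecker_one {m n : Type*} [Fintype m] [DecidableEq m] [Fintype n]
    [DecidableEq n] (φ : Matrix (m × n) (m × n) ℂ →ₗ[ℂ] ℂ) (X Y : Matrix m m ℂ) :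
    covForm φ (X ⊗ₖ 1) (Y ⊗ₖ 1) = covForm (φ ∘ₗ kronRight 1) X Y := by
  simp [covForm_apply, ← Matrix.mul_kronecker_mul]

theorem covForm_one_kronecker {m n : Type*} [Fintype m] [DecidableEq m] [Fintype n]
    [DecidableEq n] (φ : Matrix (m × n) (m × n) ℂ →ₗ[ℂ] ℂ) (X Y : Matrix n n ℂ) :
    covForm φ (1 ⊗ₖ X) (1 ⊗ₖ Y) = covForm (φ ∘ₗ kronLeft 1) X Y := by
  simp [covForm_apply, ← Matrix.mul_kronecker_mul]

/-- A local observable on the first factor commutes with one on the second. -/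
theorem covForm_kronecker_comm {m n : Type*} [Fintype m] [DecidableEq m] [Fintype n]
    [DecidableEq n] (φ : Matrix (m × n) (m × n) ℂ →ₗ[ℂ] ℂ) (X : Matrix m m ℂ)
    (Y : Matrix n n ℂ) :
    covForm φ (1 ⊗ₖ Y) (X ⊗ₖ 1) = covForm φ (X ⊗ₖ 1) (1 ⊗ₖ Y) := by
  simp [covForm_apply, ← Matrix.mul_kronecker_mul, mul_comm]

section triangle

variable {A₁ A₂ B₁ B₂ C₁ C₂ : Type*}
  [DecidableEq A₁] [DecidableEq A₂] [DecidableEq B₁] [DecidableEq B₂] [DecidableEq C₁]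
  [DecidableEq C₂]
  {φa : Matrix (B₂ × C₁) (B₂ × C₁) ℂ →ₗ[ℂ] ℂ} {φb : Matrix (C₂ × A₁) (C₂ × A₁) ℂ →ₗ[ℂ] ℂ}
  {φc : Matrix (A₂ × B₁) (A₂ × B₁) ℂ →ₗ[ℂ] ℂ}
  {Φ : Matrix ((A₁ × A₂) × (B₁ × B₂) × (C₁ × C₂)) ((A₁ × A₂) × (B₁ × B₂) × (C₁ × C₂)) ℂ →ₗ[ℂ] ℂ}

/-- `Φ` is the functional of a triangle network: it factorises over the three sources. -/
def IsTriangle (φa : Matrix (B₂ × C₁) (B₂ × C₁) ℂ →ₗ[ℂ] ℂ)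
    (φb : Matrix (C₂ × A₁) (C₂ × A₁) ℂ →ₗ[ℂ] ℂ) (φc : Matrix (A₂ × B₁) (A₂ × B₁) ℂ →ₗ[ℂ] ℂ)
    (Φ : Matrix ((A₁ × A₂) × (B₁ × B₂) × (C₁ × C₂))
      ((A₁ × A₂) × (B₁ × B₂) × (C₁ × C₂)) ℂ →ₗ[ℂ] ℂ) : Prop :=
  ∀ p₁ p₂ q₁ q₂ r₁ r₂, Φ ((p₁ ⊗ₖ p₂) ⊗ₖ ((q₁ ⊗ₖ q₂) ⊗ₖ (r₁ ⊗ₖ r₂))) =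
    φb (r₂ ⊗ₖ p₁) * φc (p₂ ⊗ₖ q₁) * φa (q₂ ⊗ₖ r₁)

/-- Two parties see only their common source, through observables averaged over the other one. -/
theorem IsTriangle.apply_AB [Fintype A₁] [Fintype A₂] [Fintype B₁] [Fintype B₂]
    (hΦ : IsTriangle φa φb φc Φ)
    (X : Matrix (A₁ × A₂) (A₁ × A₂) ℂ) (Y : Matrix (B₁ × B₂) (B₁ × B₂) ℂ) :
    Φ (X ⊗ₖ (Y ⊗ₖ 1)) = φc (averageLeft (φb ∘ₗ kronLeft 1) X ⊗ₖ
      averageRight (φa ∘ₗ kronRight 1) Y) := by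
  refine LinearMap.congr_fun (f := Φ ∘ₗ kronRight (Y ⊗ₖ 1)) (g := φc ∘ₗ kronRight
    (averageRight (φa ∘ₗ kronRight 1) Y) ∘ₗ averageLeft (φb ∘ₗ kronLeft 1))
    (linearMap_ext_kronecker fun p₁ p₂ => ?_) X
  refine LinearMap.congr_fun (f := Φ ∘ₗ kronLeft (p₁ ⊗ₖ p₂) ∘ₗ kronRight 1) (g := φc ∘ₗ kronLeft
    (averageLeft (φb ∘ₗ kronLeft 1) (p₁ ⊗ₖ p₂)) ∘ₗ averageRight (φa ∘ₗ kronRight 1))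
    (linearMap_ext_kronecker fun q₁ q₂ => ?_) Y
  have h := hΦ p₁ p₂ q₁ q₂ 1 1
  rw [Matrix.one_kronecker_one] at h
  simp [h, Matrix.smul_kronecker]
  ring

theorem IsTriangle.apply_AC [Fintype A₁] [Fintype A₂] [Fintype C₁] [Fintype C₂]
    (hΦ : IsTriangle φa φb φc Φ)
    (X : Matrix (A₁ × A₂) (A₁ × A₂) ℂ) (Z : Matrix (C₁ × C₂) (C₁ × C₂) ℂ) :
    Φ (X ⊗ₖ (1 ⊗ₖ Z)) = φb (averageLeft (φa ∘ₗ kronLeft 1) Z ⊗ₖ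
      averageRight (φc ∘ₗ kronRight 1) X) := by
  refine LinearMap.congr_fun (f := Φ ∘ₗ kronRight (1 ⊗ₖ Z)) (g := φb ∘ₗ kronLeft
    (averageLeft (φa ∘ₗ kronLeft 1) Z) ∘ₗ averageRight (φc ∘ₗ kronRight 1))
    (linearMap_ext_kronecker fun p₁ p₂ => ?_) X
  refine LinearMap.congr_fun (f := Φ ∘ₗ kronLeft (p₁ ⊗ₖ p₂) ∘ₗ kronLeft 1) (g := φb ∘ₗ kronRight
    (averageRight (φc ∘ₗ kronRight 1) (p₁ ⊗ₖ p₂)) ∘ₗ averageLeft (φa ∘ₗ kronLeft 1))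
    (linearMap_ext_kronecker fun r₁ r₂ => ?_) Z
  have h := hΦ p₁ p₂ 1 1 r₁ r₂
  rw [Matrix.one_kronecker_one] at h
  simp [h, Matrix.kronecker_smul]
  ring

theorem IsTriangle.apply_BC [Fintype B₁] [Fintype B₂] [Fintype C₁] [Fintype C₂]
    (hΦ : IsTriangle φa φb φc Φ)
    (Y : Matrix (B₁ × B₂) (B₁ × B₂) ℂ) (Z : Matrix (C₁ × C₂) (C₁ × C₂) ℂ) :
    Φ (1 ⊗ₖ (Y ⊗ₖ Z)) = φa (averageLeft (φc ∘ₗ kronLeft 1) Y ⊗ₖ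
      averageRight (φb ∘ₗ kronRight 1) Z) := by
  refine LinearMap.congr_fun (f := Φ ∘ₗ kronLeft 1 ∘ₗ kronRight Z) (g := φa ∘ₗ kronRight
    (averageRight (φb ∘ₗ kronRight 1) Z) ∘ₗ averageLeft (φc ∘ₗ kronLeft 1))
    (linearMap_ext_kronecker fun q₁ q₂ => ?_) Y
  refine LinearMap.congr_fun (f := Φ ∘ₗ kronLeft 1 ∘ₗ kronLeft (q₁ ⊗ₖ q₂)) (g := φa ∘ₗ kronLeft
    (averageLeft (φc ∘ₗ kronLeft 1) (q₁ ⊗ₖ q₂)) ∘ₗ averageRight (φb ∘ₗ kronRight 1))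
    (linearMap_ext_kronecker fun r₁ r₂ => ?_) Z
  have h := hΦ 1 1 q₁ q₂ r₁ r₂
  rw [Matrix.one_kronecker_one] at h
  simp [h, Matrix.smul_kronecker]
  ring

omit [DecidableEq A₁] [DecidableEq A₂] in
/-- Each party holds a product state. -/
theorem IsTriangle.apply_A (hΦ : IsTriangle φa φb φc Φ) (ha : φa 1 = 1)
    (p : Matrix A₁ A₁ ℂ) (q : Matrix A₂ A₂ ℂ) :
    (Φ ∘ₗ kronRight 1) (p ⊗ₖ q) = (φb ∘ₗ kronLeft 1) p * (φc ∘ₗ kronRight 1) q := by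
  have h := hΦ p q 1 1 1 1
  simp only [Matrix.one_kronecker_one, ha, mul_one] at h
  simpa using h

omit [DecidableEq B₁] [DecidableEq B₂] in
theorem IsTriangle.apply_B (hΦ : IsTriangle φa φb φc Φ) (hb : φb 1 = 1)
    (p : Matrix B₁ B₁ ℂ) (q : Matrix B₂ B₂ ℂ) :
    ((Φ ∘ₗ kronLeft 1) ∘ₗ kronRight 1) (p ⊗ₖ q) =
      (φc ∘ₗ kronLeft 1) p * (φa ∘ₗ kronRight 1) q := by
  have h := hΦ 1 1 p q 1 1
  simp only [Matrix.one_kronecker_one, hb, one_mul] at h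
  simpa using h

omit [DecidableEq C₁] [DecidableEq C₂] in
theorem IsTriangle.apply_C (hΦ : IsTriangle φa φb φc Φ) (hc : φc 1 = 1)
    (p : Matrix C₁ C₁ ℂ) (q : Matrix C₂ C₂ ℂ) :
    ((Φ ∘ₗ kronLeft 1) ∘ₗ kronLeft 1) (p ⊗ₖ q) =
      (φa ∘ₗ kronLeft 1) p * (φb ∘ₗ kronRight 1) q := by
  have h := hΦ 1 1 1 1 p q
  simp only [Matrix.one_kronecker_one, hc, mul_one] at h
  simpa [mul_comm] using h

theorem averageLeft_one {m n : Type*} [DecidableEq m] [DecidableEq n]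
    {f : Matrix m m ℂ →ₗ[ℂ] ℂ} (hf : f 1 = 1) :
    averageLeft f (1 : Matrix (m × n) (m × n) ℂ) = 1 := by
  rw [← Matrix.one_kronecker_one, averageLeft_kronecker, hf, one_smul]

theorem averageRight_one {m n : Type*} [DecidableEq m] [DecidableEq n]
    {g : Matrix n n ℂ →ₗ[ℂ] ℂ} (hg : g 1 = 1) :
    averageRight g (1 : Matrix (m × n) (m × n) ℂ) = 1 := by
  rw [← Matrix.one_kronecker_one, averageRight_kronecker, hg, one_smul]

variable [Fintype A₁] [Fintype A₂] [Fintype B₁] [Fintype B₂] [Fintype C₁] [Fintype C₂]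

theorem IsTriangle.covForm_AB (hΦ : IsTriangle φa φb φc Φ) (ha : φa 1 = 1) (hb : φb 1 = 1)
    (X : Matrix (A₁ × A₂) (A₁ × A₂) ℂ) (Y : Matrix (B₁ × B₂) (B₁ × B₂) ℂ) :
    covForm Φ (X ⊗ₖ (1 ⊗ₖ 1)) (1 ⊗ₖ (Y ⊗ₖ 1)) =
      covForm φc (averageLeft (φb ∘ₗ kronLeft 1) X ⊗ₖ 1)
        (1 ⊗ₖ averageRight (φa ∘ₗ kronRight 1) Y) := by
  have ha' : (φa ∘ₗ kronRight 1) (1 : Matrix B₂ B₂ ℂ) = 1 := by simp [ha]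
  have hb' : (φb ∘ₗ kronLeft 1) (1 : Matrix A₁ A₁ ℂ) = 1 := by simp [hb]
  simp only [covForm_apply, ← Matrix.mul_kronecker_mul, mul_one, one_mul, hΦ.apply_AB,
    averageLeft_one hb', averageRight_one ha']

theorem IsTriangle.covForm_AC (hΦ : IsTriangle φa φb φc Φ) (ha : φa 1 = 1) (hc : φc 1 = 1)
    (X : Matrix (A₁ × A₂) (A₁ × A₂) ℂ) (Z : Matrix (C₁ × C₂) (C₁ × C₂) ℂ) :
    covForm Φ (X ⊗ₖ (1 ⊗ₖ 1)) (1 ⊗ₖ (1 ⊗ₖ Z)) =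
      covForm φb (1 ⊗ₖ averageRight (φc ∘ₗ kronRight 1) X)
        (averageLeft (φa ∘ₗ kronLeft 1) Z ⊗ₖ 1) := by
  have ha' : (φa ∘ₗ kronLeft 1) (1 : Matrix C₁ C₁ ℂ) = 1 := by simp [ha]
  have hc' : (φc ∘ₗ kronRight 1) (1 : Matrix A₂ A₂ ℂ) = 1 := by simp [hc]
  simp only [covForm_apply, ← Matrix.mul_kronecker_mul, mul_one, one_mul, hΦ.apply_AC,
    averageLeft_one ha', averageRight_one hc']

theorem IsTriangle.covForm_BC (hΦ : IsTriangle φa φb φc Φ) (hb : φb 1 = 1) (hc : φc 1 = 1)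
    (Y : Matrix (B₁ × B₂) (B₁ × B₂) ℂ) (Z : Matrix (C₁ × C₂) (C₁ × C₂) ℂ) :
    covForm Φ (1 ⊗ₖ (Y ⊗ₖ 1)) (1 ⊗ₖ (1 ⊗ₖ Z)) =
      covForm φa (averageLeft (φc ∘ₗ kronLeft 1) Y ⊗ₖ 1)
        (1 ⊗ₖ averageRight (φb ∘ₗ kronRight 1) Z) := by
  have hb' : (φb ∘ₗ kronRight 1) (1 : Matrix C₂ C₂ ℂ) = 1 := by simp [hb]
  have hc' : (φc ∘ₗ kronLeft 1) (1 : Matrix B₁ B₁ ℂ) = 1 := by simp [hc]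
  simp only [covForm_apply, ← Matrix.mul_kronecker_mul, mul_one, one_mul, hΦ.apply_BC,
    averageLeft_one hc', averageRight_one hb']

end triangle

/-! ### Block matrices -/

theorem Matrix.PosSemidef.fromBlocks_zero_right {m n : Type*} [Finite m] [Finite n]
    {R : Matrix m m ℂ} (hR : R.PosSemidef) :
    (Matrix.fromBlocks R 0 0 (0 : Matrix n n ℂ)).PosSemidef := by
  classical
  have := Fintype.ofFinite m
  convert hR.conjTranspose_mul_mul_same
    (Matrix.fromCols (1 : Matrix m m ℂ) (0 : Matrix m n ℂ)) using 1
  ext (i | i) (j | j) <;>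
    simp [Matrix.mul_apply, Matrix.fromCols, Matrix.one_apply, apply_ite star]

theorem Matrix.PosSemidef.fromBlocks_zero_left {m n : Type*} [Finite m] [Finite n]
    {R : Matrix n n ℂ} (hR : R.PosSemidef) :
    (Matrix.fromBlocks (0 : Matrix m m ℂ) 0 0 R).PosSemidef := by
  classical
  have := Fintype.ofFinite n
  convert hR.conjTranspose_mul_mul_same
    (Matrix.fromCols (0 : Matrix n m ℂ) (1 : Matrix n n ℂ)) using 1
  ext (i | i) (j | j) <;>
    simp [Matrix.mul_apply, Matrix.fromCols, Matrix.one_apply, apply_ite star]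

/-! ### The decomposition -/

/-- The decomposition in terms of functionals: `Φ` is the functional of a triangle of sources and
`Ψ` arises from it by local Schwarz maps, the Heisenberg duals of the channels. -/
theorem IsTriangle.exists_decomposition
    {A₁ A₂ B₁ B₂ C₁ C₂ A B C I J K : Type*}
    [Fintype A₁] [DecidableEq A₁] [Fintype A₂] [DecidableEq A₂]
    [Fintype B₁] [DecidableEq B₁] [Fintype B₂] [DecidableEq B₂]
    [Fintype C₁] [DecidableEq C₁] [Fintype C₂] [DecidableEq C₂]
    [Fintype A] [DecidableEq A] [Fintype B] [DecidableEq B] [Fintype C] [DecidableEq C]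
    [Finite I] [Finite J] [Finite K]
    {φa : Matrix (B₂ × C₁) (B₂ × C₁) ℂ →ₗ[ℂ] ℂ} {φb : Matrix (C₂ × A₁) (C₂ × A₁) ℂ →ₗ[ℂ] ℂ}
    {φc : Matrix (A₂ × B₁) (A₂ × B₁) ℂ →ₗ[ℂ] ℂ}
    {Φ : Matrix ((A₁ × A₂) × (B₁ × B₂) × (C₁ × C₂))
      ((A₁ × A₂) × (B₁ × B₂) × (C₁ × C₂)) ℂ →ₗ[ℂ] ℂ}
    (ea : IsExpectation φa) (eb : IsExpectation φb) (ec : IsExpectation φc)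
    (eΦ : IsExpectation Φ) (hΦ : IsTriangle φa φb φc Φ)
    {DA : Matrix A A ℂ →ₗ[ℂ] Matrix (A₁ × A₂) (A₁ × A₂) ℂ}
    {DB : Matrix B B ℂ →ₗ[ℂ] Matrix (B₁ × B₂) (B₁ × B₂) ℂ}
    {DC : Matrix C C ℂ →ₗ[ℂ] Matrix (C₁ × C₂) (C₁ × C₂) ℂ}
    (hDA : IsSchwarzMap DA) (hDB : IsSchwarzMap DB) (hDC : IsSchwarzMap DC)
    {Ψ : Matrix (A × B × C) (A × B × C) ℂ →ₗ[ℂ] ℂ}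
    (hΨ : ∀ x y z, Ψ (x ⊗ₖ (y ⊗ₖ z)) = Φ (DA x ⊗ₖ (DB y ⊗ₖ DC z)))
    (a : I → Matrix A A ℂ) (b : J → Matrix B B ℂ) (c : K → Matrix C C ℂ)
    (ha : ∀ i, (a i).IsHermitian) (hb : ∀ j, (b j).IsHermitian) (hc : ∀ k, (c k).IsHermitian)
    (Γ : Matrix (I ⊕ J ⊕ K) (I ⊕ J ⊕ K) ℂ)
    (hΓ : ∀ s t, Γ s t = covForm Ψ (localObs a b c s) (localObs a b c t)) :
    ∃ (ΥA₁ ΥA₂ : Matrix I I ℂ) (ΥB₁ ΥB₂ : Matrix J J ℂ) (ΥC₁ ΥC₂ : Matrix K K ℂ),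
      (block3 ΥA₂ (gammaE Γ) (0 : Matrix I K ℂ)
              (gammaE Γ)ᵀ ΥB₁ 0
              0 0 0).PosSemidef ∧
      (block3 ΥA₁ (0 : Matrix I J ℂ) (gammaF Γ)
              0 0 0
              (gammaF Γ)ᵀ 0 ΥC₂).PosSemidef ∧
      (block3 (0 : Matrix I I ℂ) 0 0
              0 ΥB₂ (gammaG Γ)
              0 (gammaG Γ)ᵀ ΥC₁).PosSemidef ∧
      Γ = block3 ΥA₂ (gammaE Γ) 0
                 (gammaE Γ)ᵀ ΥB₁ 0
                 0 0 0
        + block3 ΥA₁ (0 : Matrix I J ℂ) (gammaF Γ)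
                 0 0 0
                 (gammaF Γ)ᵀ 0 ΥC₂
        + block3 (0 : Matrix I I ℂ) 0 0
                 0 ΥB₂ (gammaG Γ)
                 0 (gammaG Γ)ᵀ ΥC₁ := by
  have hA : ∀ i, (DA (a i)).IsHermitian := fun i => by
    rw [Matrix.IsHermitian, ← hDA.map_conjTranspose, (ha i).eq]
  have hB : ∀ j, (DB (b j)).IsHermitian := fun j => by
    rw [Matrix.IsHermitian, ← hDB.map_conjTranspose, (hb j).eq]
  have hC : ∀ k, (DC (c k)).IsHermitian := fun k => by
    rw [Matrix.IsHermitian, ← hDC.map_conjTranspose, (hc k).eq]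
  -- The observables, averaged over one of the two sources a party is connected to; the index is
  -- the subsystem that remains.
  let uA₁ i := averageRight (φc ∘ₗ kronRight 1) (DA (a i))
  let uA₂ i := averageLeft (φb ∘ₗ kronLeft 1) (DA (a i))
  let uB₁ j := averageRight (φa ∘ₗ kronRight 1) (DB (b j))
  let uB₂ j := averageLeft (φc ∘ₗ kronLeft 1) (DB (b j))
  let uC₁ k := averageRight (φb ∘ₗ kronRight 1) (DC (c k))
  let uC₂ k := averageLeft (φa ∘ₗ kronLeft 1) (DC (c k))
  -- The off-diagonal blocks of `Γ`.
  have hAB : ∀ i j, Γ (.inl i) (.inr (.inl j)) = covForm φc (uA₂ i ⊗ₖ 1) (1 ⊗ₖ uB₁ j) :=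
    fun i j => by
      rw [hΓ, ← hΦ.covForm_AB ea.map_one eb.map_one]
      simp only [localObs, covForm_apply, ← Matrix.mul_kronecker_mul, mul_one, one_mul, hΨ,
        hDA.map_one, hDB.map_one, hDC.map_one]
  have hAC : ∀ i k, Γ (.inl i) (.inr (.inr k)) = covForm φb (1 ⊗ₖ uA₁ i) (uC₂ k ⊗ₖ 1) :=
    fun i k => by
      rw [hΓ, ← hΦ.covForm_AC ea.map_one ec.map_one]
      simp only [localObs, covForm_apply, ← Matrix.mul_kronecker_mul, mul_one, one_mul, hΨ,
        hDA.map_one, hDB.map_one, hDC.map_one]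
  have hBC : ∀ j k, Γ (.inr (.inl j)) (.inr (.inr k)) = covForm φa (uB₂ j ⊗ₖ 1) (1 ⊗ₖ uC₁ k) :=
    fun j k => by
      rw [hΓ, ← hΦ.covForm_BC eb.map_one ec.map_one]
      simp only [localObs, covForm_apply, ← Matrix.mul_kronecker_mul, mul_one, one_mul, hΨ,
        hDA.map_one, hDB.map_one, hDC.map_one]
  have hBA : ∀ i j, Γ (.inr (.inl j)) (.inl i) = Γ (.inl i) (.inr (.inl j)) := fun i j => by
    rw [hΓ, hΓ]
    simp only [localObs, Matrix.one_kronecker_one]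
    exact covForm_kronecker_comm _ _ _
  have hCA : ∀ i k, Γ (.inr (.inr k)) (.inl i) = Γ (.inl i) (.inr (.inr k)) := fun i k => by
    rw [hΓ, hΓ]
    simp only [localObs, Matrix.one_kronecker_one]
    exact covForm_kronecker_comm _ _ _
  have hCB : ∀ j k, Γ (.inr (.inr k)) (.inr (.inl j)) = Γ (.inr (.inl j)) (.inr (.inr k)) :=
    fun j k => by
      rw [hΓ, hΓ]
      simp only [localObs, covForm_one_kronecker]
      exact covForm_kronecker_comm _ _ _
  -- The covariance matrices of the averaged observables in the three source states.
  have TE := ec.covForm_posSemidef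
    (Sum.elim (fun i => uA₂ i ⊗ₖ 1) (Sum.elim (fun j => 1 ⊗ₖ uB₁ j) fun _ : K => 0)) (by
      rintro (i | j | k)
      exacts [(eb.comp_kronLeft.averageLeft_isHermitian (hA i)).kronecker_one,
        (ea.comp_kronRight.averageRight_isHermitian (hB j)).one_kronecker,
        Matrix.isHermitian_zero])
  have TF := eb.covForm_posSemidef
    (Sum.elim (fun i => 1 ⊗ₖ uA₁ i) (Sum.elim (fun _ : J => 0) fun k => uC₂ k ⊗ₖ 1)) (by
      rintro (i | j | k)
      exacts [(ec.comp_kronRight.averageRight_isHermitian (hA i)).one_kronecker,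
        Matrix.isHermitian_zero,
        (ea.comp_kronLeft.averageLeft_isHermitian (hC k)).kronecker_one])
  have TG := ea.covForm_posSemidef
    (Sum.elim (fun _ : I => 0) (Sum.elim (fun j => uB₂ j ⊗ₖ 1) fun k => 1 ⊗ₖ uC₁ k)) (by
      rintro (i | j | k)
      exacts [Matrix.isHermitian_zero,
        (ec.comp_kronLeft.averageLeft_isHermitian (hB j)).kronecker_one,
        (eb.comp_kronRight.averageRight_isHermitian (hC k)).one_kronecker])
  -- What they leave of the diagonal blocks of `Γ`, once these are written in terms of `Φ`.
  have eA : IsExpectation (Φ ∘ₗ kronRight 1) := eΦ.comp_kronRight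
  have eBC : IsExpectation (Φ ∘ₗ kronLeft 1) := eΦ.comp_kronLeft
  have RA := residual_posSemidef eA eb.comp_kronLeft ec.comp_kronRight
    (hΦ.apply_A ea.map_one) hDA a ha
  have RB := residual_posSemidef eBC.comp_kronRight ec.comp_kronLeft ea.comp_kronRight
    (hΦ.apply_B eb.map_one) hDB b hb
  have RC := residual_posSemidef eBC.comp_kronLeft ea.comp_kronLeft eb.comp_kronRight
    (hΦ.apply_C ec.map_one) hDC c hc
  have hAA : ∀ i i', Γ (.inl i) (.inl i') = (Φ ∘ₗ kronRight 1) (DA (a i * a i'))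
      - (Φ ∘ₗ kronRight 1) (DA (a i)) * (Φ ∘ₗ kronRight 1) (DA (a i')) := fun i i' => by
    simp only [hΓ, localObs, covForm_apply, ← Matrix.mul_kronecker_mul, mul_one, hΨ, hDB.map_one,
      hDC.map_one]
    simp only [LinearMap.comp_apply, kronRight_apply, Matrix.one_kronecker_one]
  have hBB : ∀ j j', Γ (.inr (.inl j)) (.inr (.inl j')) =
      ((Φ ∘ₗ kronLeft 1) ∘ₗ kronRight 1) (DB (b j * b j'))
      - ((Φ ∘ₗ kronLeft 1) ∘ₗ kronRight 1) (DB (b j))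
        * ((Φ ∘ₗ kronLeft 1) ∘ₗ kronRight 1) (DB (b j')) := fun j j' => by
    simp [hΓ, localObs, covForm_apply, ← Matrix.mul_kronecker_mul, hΨ, hDA.map_one, hDC.map_one]
  have hCC : ∀ k k', Γ (.inr (.inr k)) (.inr (.inr k')) =
      ((Φ ∘ₗ kronLeft 1) ∘ₗ kronLeft 1) (DC (c k * c k'))
      - ((Φ ∘ₗ kronLeft 1) ∘ₗ kronLeft 1) (DC (c k))
        * ((Φ ∘ₗ kronLeft 1) ∘ₗ kronLeft 1) (DC (c k')) := fun k k' => by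
    simp [hΓ, localObs, covForm_apply, ← Matrix.mul_kronecker_mul, hΨ, hDA.map_one, hDB.map_one]
  -- The residual of `A` joins the first summand, that of `C` the second, that of `B` the third.
  refine ⟨Matrix.of fun i i' => covForm φb (1 ⊗ₖ uA₁ i) (1 ⊗ₖ uA₁ i'),
    Matrix.of fun i i' => Γ (.inl i) (.inl i') - covForm φb (1 ⊗ₖ uA₁ i) (1 ⊗ₖ uA₁ i'),
    Matrix.of fun j j' => covForm φc (1 ⊗ₖ uB₁ j) (1 ⊗ₖ uB₁ j'),
    Matrix.of fun j j' => Γ (.inr (.inl j)) (.inr (.inl j'))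
      - covForm φc (1 ⊗ₖ uB₁ j) (1 ⊗ₖ uB₁ j'),
    Matrix.of fun k k' => covForm φa (1 ⊗ₖ uC₁ k) (1 ⊗ₖ uC₁ k'),
    Matrix.of fun k k' => Γ (.inr (.inr k)) (.inr (.inr k'))
      - covForm φa (1 ⊗ₖ uC₁ k) (1 ⊗ₖ uC₁ k'), ?_, ?_, ?_, ?_⟩
  · convert TE.add (RA.fromBlocks_zero_right (n := J ⊕ K)) using 1
    ext (i | j | k) (i' | j' | k') <;>
      simp [block3, gammaE, hAB, hAA, uA₁, uA₂, covForm_kronecker_comm φc, covForm_kronecker_one φc,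
        covForm_one_kronecker φb]
    ring
  · convert TF.add ((RC.fromBlocks_zero_left (m := J)).fromBlocks_zero_left (m := I)) using 1
    ext (i | j | k) (i' | j' | k') <;>
      simp [block3, gammaF, hAC, hCC, uC₁, uC₂, covForm_kronecker_comm φb, covForm_kronecker_one φb,
        covForm_one_kronecker φa]
    ring
  · convert TG.add ((RB.fromBlocks_zero_right (n := K)).fromBlocks_zero_left (m := I)) using 1
    ext (i | j | k) (i' | j' | k') <;>
      simp [block3, gammaG, hBC, hBB, uB₁, uB₂, covForm_kronecker_comm φa, covForm_kronecker_one φa,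
        covForm_one_kronecker φc]
    ring
  · ext (i | j | k) (i' | j' | k') <;> simp [block3, gammaE, gammaF, gammaG, hBA, hCA, hCB]

theorem proposition5
    {A₁ A₂ B₁ B₂ C₁ C₂ A B C I J K : Type*}
    [Fintype A₁] [DecidableEq A₁] [Fintype A₂] [DecidableEq A₂]
    [Fintype B₁] [DecidableEq B₁] [Fintype B₂] [DecidableEq B₂]
    [Fintype C₁] [DecidableEq C₁] [Fintype C₂] [DecidableEq C₂]
    [Fintype A] [DecidableEq A] [Fintype B] [DecidableEq B] [Fintype C] [DecidableEq C]
    [Fintype I] [Fintype J] [Fintype K]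
    (ρa : Matrix (B₂ × C₁) (B₂ × C₁) ℂ) (ρb : Matrix (C₂ × A₁) (C₂ × A₁) ℂ)
    (ρc : Matrix (A₂ × B₁) (A₂ × B₁) ℂ)
    (hρa : IsState ρa) (hρb : IsState ρb) (hρc : IsState ρc)
    (EA : Matrix (A₁ × A₂) (A₁ × A₂) ℂ →ₗ[ℂ] Matrix A A ℂ)
    (EB : Matrix (B₁ × B₂) (B₁ × B₂) ℂ →ₗ[ℂ] Matrix B B ℂ)
    (EC : Matrix (C₁ × C₂) (C₁ × C₂) ℂ →ₗ[ℂ] Matrix C C ℂ)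
    (hEA : IsChannel EA) (hEB : IsChannel EB) (hEC : IsChannel EC)
    (a : I → Matrix A A ℂ) (b : J → Matrix B B ℂ) (c : K → Matrix C C ℂ)
    (ha : ∀ i, (a i).IsHermitian) (hb : ∀ j, (b j).IsHermitian) (hc : ∀ k, (c k).IsHermitian)
    (Γ : Matrix (I ⊕ J ⊕ K) (I ⊕ J ⊕ K) ℂ)
    (hΓ : Γ = covMatrix (localObs a b c) (ctnState EA EB EC ρa ρb ρc)) :
    ∃ (ΥA₁ ΥA₂ : Matrix I I ℂ) (ΥB₁ ΥB₂ : Matrix J J ℂ) (ΥC₁ ΥC₂ : Matrix K K ℂ),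
      (block3 ΥA₂ (gammaE Γ) (0 : Matrix I K ℂ)
              (gammaE Γ)ᵀ ΥB₁ 0
              0 0 0).PosSemidef ∧
      (block3 ΥA₁ (0 : Matrix I J ℂ) (gammaF Γ)
              0 0 0
              (gammaF Γ)ᵀ 0 ΥC₂).PosSemidef ∧
      (block3 (0 : Matrix I I ℂ) 0 0
              0 ΥB₂ (gammaG Γ)
              0 (gammaG Γ)ᵀ ΥC₁).PosSemidef ∧
      Γ = block3 ΥA₂ (gammaE Γ) 0
                 (gammaE Γ)ᵀ ΥB₁ 0
                 0 0 0
        + block3 ΥA₁ (0 : Matrix I J ℂ) (gammaF Γ)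
                 0 0 0
                 (gammaF Γ)ᵀ 0 ΥC₂
        + block3 (0 : Matrix I I ℂ) 0 0
                 0 ΥB₂ (gammaG Γ)
                 0 (gammaG Γ)ᵀ ΥC₁ := by
  obtain ⟨DA, hDA, hdA⟩ := hEA.exists_heisenberg_dual
  obtain ⟨DB, hDB, hdB⟩ := hEB.exists_heisenberg_dual
  obtain ⟨DC, hDC, hdC⟩ := hEC.exists_heisenberg_dual
  refine IsTriangle.exists_decomposition (Ψ := expectationLM (ctnState EA EB EC ρa ρb ρc))
    hρa.isExpectation hρb.isExpectation hρc.isExpectation (hρa.btnState hρb hρc).isExpectation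
    (expectationLM_btnState ρa ρb ρc) hDA hDB hDC (fun x y z => ?_) a b c ha hb hc Γ
    fun s t => ?_
  · exact trace_kronecker_mul_tensorMap (hdA x) (trace_kronecker_mul_tensorMap (hdB y) (hdC z)) _
  · rw [covForm_apply, hΓ]
    rfl
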